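/- Let $m,n\ge 1$, $q=\min\{m,n\}$, and let $\mathcal M_{m,n}$ be the space of complex $m\times n$ matrices. For $F\in\mathcal M_{m,n}$ let $s(F)=(s_1(F),\dots,s_q(F))$ be its singular values in nonincreasing order. A matrix $X\in\mathcal M_{m,n}$ is a partial isometry if $\|Xf\|=\|f\|$ for all $f\in\ker(X)^\perp$ (Euclidean norms); let $\mathcal I_{m,n}^k$ be the set of partial isometries $X\in\mathcal M_{m,n}$ of rank $k$. A symmetric gauge function is a norm $\Phi$ on $\mathbb R^q$ with $\Phi(x_1,\dots,x_q)=\Phi(|x_{\sigma(1)}|,\dots,|x_{\sigma(q)}|)$ for all $x\in\mathbb R^q$ and all permutations $\sigma$ of $\{1,\dots,q\}$; put $\|F\|_\Phi=\Phi(s_1(F),\dots,s_q(F))$. A norm $N$ on $\mathcal M_{m,n}$ is unitarily invariant if $N(PFQ)=N(F)$ for all $F\in\mathcal M_{m,n}$ and all unitary matrices $P$ of size $m$ and $Q$ of size $n$. **Theorem.** Let $1\le k\le q$, let $F\in\mathcal M_{m,n}$ have rank $r$, and let $F=V\Sigma W^*$ be any singular value decomposition of $F$, that is, $V$ and $W$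 are unitary matrices of sizes $m$ and $n$ and $$\Sigma=\begin{bmatrix}\operatorname{diag}(s_1(F),\dots,s_r(F))&0\\0&0_{m-r,n-r}\end{bmatrix}.$$ Then the matrix $$U_k=V\begin{bmatrix}I_k&0\\0&0_{m-k,n-k}\end{bmatrix}W^*$$ belongs to $\mathcal I_{m,n}^k$, and for every symmetric gauge function $\Phi$ on $\mathbb R^q$, $$\|F-U_k\|_\Phi=\min\{\,\|F-X\|_\Phi : X\in\mathcal I_{m,n}^k\,\}.$$ Likewise, for every unitarily invariant norm $N$ on $\mathcal M_{m,n}$, $$N(F-U_k)=\min\{\,N(F-X) : X\in\mathcal I_{m,n}^k\,\}.$$ -/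

import Mathlib

namespace PartialIsometryApprox

open scoped Matrix

/-- The singular values `s₁(F) ≥ s₂(F) ≥ ⋯` of a complex `m × n` matrix (indexed from `0`, and
continued by zeros), i.e. the square roots of the eigenvalues of `F* F`, in nonincreasing order. -/
noncomputable def sv {m n : ℕ} (F : Matrix (Fin m) (Fin n) ℂ) : ℕ → ℝ :=
  fun i => (Matrix.toEuclideanLin F).singularValues i

/-- The vector `s(F) = (s₁(F), …, s_q(F))`, where `q = min {m, n}`. -/
noncomputable def svVec {m n : ℕ} (F : Matrix (Fin m) (Fin n) ℂ) : Fin (min m n) → ℝ :=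
  fun i => sv F i

/-- The `m × n` block matrix with upper left block `diag(d₁, …, d_r)` and zeros elsewhere. -/
noncomputable def blockDiag (m n r : ℕ) (d : ℕ → ℝ) : Matrix (Fin m) (Fin n) ℂ :=
  Matrix.of fun i j => if (i : ℕ) = (j : ℕ) ∧ (i : ℕ) < r then ((d i : ℝ) : ℂ) else 0

/-- `F = V Σ W*` is a singular value decomposition of `F`. -/
structure IsSVD {m n : ℕ} (F : Matrix (Fin m) (Fin n) ℂ)
    (V : Matrix (Fin m) (Fin m) ℂ) (W : Matrix (Fin n) (Fin n) ℂ) : Prop where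
  left_unitary : V ∈ Matrix.unitaryGroup (Fin m) ℂ
  right_unitary : W ∈ Matrix.unitaryGroup (Fin n) ℂ
  eq_mul : F = V * blockDiag m n F.rank (sv F) * Wᴴ

/-- `X` is a partial isometry: `‖X f‖ = ‖f‖` for all `f` in `(ker X)ᗮ` (Euclidean norms). -/
def IsPartialIsometry {m n : ℕ} (X : Matrix (Fin m) (Fin n) ℂ) : Prop :=
  ∀ f ∈ (LinearMap.ker (Matrix.toEuclideanLin X))ᗮ, ‖Matrix.toEuclideanLin X f‖ = ‖f‖

/-- The set of `m × n` partial isometries of rank `k`. -/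
def partialIsometries (m n k : ℕ) : Set (Matrix (Fin m) (Fin n) ℂ) :=
  {X | IsPartialIsometry X ∧ X.rank = k}

/-- `Φ` is a symmetric gauge function: a norm on `ℝ^q` which depends only on the absolute values of
the coordinates, and not on their order. -/
structure IsSymmetricGauge {q : ℕ} (Φ : Seminorm ℝ (Fin q → ℝ)) : Prop where
  eq_zero_of_map_eq_zero : ∀ x, Φ x = 0 → x = 0
  map_abs_perm : ∀ (σ : Equiv.Perm (Fin q)) (x : Fin q → ℝ), Φ x = Φ (fun i => |x (σ i)|)

/-- `‖F‖_Φ = Φ(s₁(F), …, s_q(F))`. -/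
noncomputable def gaugeNorm {m n : ℕ} (Φ : Seminorm ℝ (Fin (min m n) → ℝ))
    (F : Matrix (Fin m) (Fin n) ℂ) : ℝ :=
  Φ (svVec F)

/-- `N` is a unitarily invariant norm on the space of complex `m × n` matrices. -/
structure IsUnitarilyInvariantNorm {m n : ℕ} (N : Seminorm ℂ (Matrix (Fin m) (Fin n) ℂ)) :
    Prop where
  eq_zero_of_map_eq_zero : ∀ F, N F = 0 → F = 0
  map_unitary_mul_mul_unitary :
    ∀ P ∈ Matrix.unitaryGroup (Fin m) ℂ, ∀ Q ∈ Matrix.unitaryGroup (Fin n) ℂ,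
      ∀ F : Matrix (Fin m) (Fin n) ℂ, N (P * F * Q) = N F

/-- The matrix `U_k = V diag(I_k, 0) W*`. -/
noncomputable def truncIsometry {m n : ℕ} (k : ℕ)
    (V : Matrix (Fin m) (Fin m) ℂ) (W : Matrix (Fin n) (Fin n) ℂ) : Matrix (Fin m) (Fin n) ℂ :=
  V * blockDiag m n k (fun _ => 1) * Wᴴ

end PartialIsometryApprox

open scoped InnerProductSpace Matrix
open Module

/-! The proof rests on Mirsky's inequality `Φ (s(A) - s(B)) ≤ ‖A - B‖_Φ`. Every partial isometry of
rank `k` has singular values `(1, …, 1, 0, …, 0)` with `k` ones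
(`svVec_eq_of_mem_partialIsometries`), so `Φ (s(F) - (1, …, 1, 0, …, 0))` bounds all the distances
from below. It is attained at `U_k`: there `F - U_k` is `V diag(s(F) - (1, …, 1, 0, …, 0)) W*`,
whose singular values are the absolute values of the diagonal entries, reordered.

Mirsky's inequality follows from a weak majorization of `|s(A) - s(B)|` by `s(A - B)`
(`sum_abs_sub_le`), under which gauge functions are monotone (`IsSymmetricGauge.le_of_sum_le`). The
majorization comes from Weyl monotonicity and a trace count for the self-adjoint dilations, whose
extreme eigenvalues are the singular values with both signs. A unitarily invariant norm reduces to
the gauge function `x ↦ N (diag x)`. -/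

namespace PartialIsometryApprox

/-! ### Variational estimates for eigenvalues of symmetric operators. -/

section Spectral

variable {E : Type*} [NormedAddCommGroup E] [InnerProductSpace ℂ E] {ι : Type*} [Fintype ι]

/-- The operator `∑ cⱼ |eⱼ⟩⟨eⱼ|`. -/
noncomputable def diagOp (e : ι → E) (c : ι → ℝ) : E →ₗ[ℂ] E :=
  ∑ j, (c j : ℂ) • (InnerProductSpace.rankOne ℂ (e j) (e j) : E →L[ℂ] E).toLinearMap

theorem diagOp_apply (e : ι → E) (c : ι → ℝ) (x : E) :
    diagOp e c x = ∑ j, (c j : ℂ) • ⟪e j, x⟫_ℂ • e j := by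
  simp [diagOp, LinearMap.sum_apply]

theorem isSymmetric_diagOp (e : ι → E) (c : ι → ℝ) : (diagOp e c).IsSymmetric := by
  intro x y
  simp only [diagOp_apply, sum_inner, inner_sum, inner_smul_left, inner_smul_right,
    Complex.conj_ofReal, inner_conj_symm]
  exact Finset.sum_congr rfl fun j _ => by ring

theorem re_inner_diagOp (e : ι → E) (c : ι → ℝ) (x : E) :
    (⟪x, diagOp e c x⟫_ℂ).re = ∑ j, c j * ‖⟪e j, x⟫_ℂ‖ ^ 2 := by
  simp only [diagOp_apply, inner_sum, inner_smul_right, Complex.re_sum]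
  refine Finset.sum_congr rfl fun j _ => ?_
  rw [← inner_conj_symm x (e j), Complex.mul_conj, Complex.normSq_eq_norm_sq,
    ← Complex.ofReal_mul, Complex.ofReal_re]

theorem re_trace_diagOp [FiniteDimensional ℂ E] {e : ι → E} (he : Orthonormal ℂ e) (c : ι → ℝ) :
    ((diagOp e c).trace ℂ E).re = ∑ j, c j := by
  simp [diagOp, InnerProductSpace.trace_rankOne, inner_self_eq_norm_sq_to_K, he.1]

theorem sum_sq_inner_le {e : ι → E} (he : Orthonormal ℂ e) (x : E) :
    ∑ j, ‖⟪e j, x⟫_ℂ‖ ^ 2 ≤ ‖x‖ ^ 2 :=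
  he.sum_inner_products_le x

omit [Fintype ι] in
theorem finrank_span_image {e : ι → E} (he : Orthonormal ℂ e) (J : Finset ι) :
    finrank ℂ (Submodule.span ℂ (e '' J)) = J.card := by
  classical
  have h := he.linearIndependent.comp ((↑) : J → ι) Subtype.val_injective
  have := finrank_span_eq_card h
  rw [Set.range_comp, Subtype.range_coe_subtype] at this
  simpa using this

omit [Fintype ι] in
theorem inner_eq_zero_of_mem_orthogonal_span {e : ι → E} {J : Finset ι} {x : E}
    (hx : x ∈ (Submodule.span ℂ (e '' J))ᗮ) {j : ι} (hj : j ∈ J) : ⟪e j, x⟫_ℂ = 0 :=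
  hx _ (Submodule.subset_span ⟨j, hj, rfl⟩)

omit [Fintype ι] in
theorem inner_of_mem_span {e : ι → E} (he : Orthonormal ℂ e) {J : Finset ι} {x : E}
    (hx : x ∈ Submodule.span ℂ (e '' J)) :
    (∀ j ∉ J, ⟪e j, x⟫_ℂ = 0) ∧ ∑ j ∈ J, ‖⟪e j, x⟫_ℂ‖ ^ 2 = ‖x‖ ^ 2 := by
  classical
  obtain ⟨b, hb⟩ := (Submodule.mem_span_image_finset_iff_exists_fun ℂ).1 hx
  obtain ⟨a, rfl⟩ : ∃ a : ι → ℂ, ∑ i ∈ J, a i • e i = x :=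
    ⟨fun i => if h : i ∈ J then b ⟨i, h⟩ else 0, by rw [← hb, ← Finset.sum_coe_sort]; simp⟩
  have h : ∀ j ∈ J, ⟪e j, ∑ i ∈ J, a i • e i⟫_ℂ = a j := fun j hj => he.inner_right_sum a hj
  refine ⟨fun j hj => ?_, ?_⟩
  · rw [inner_sum]
    refine Finset.sum_eq_zero fun i hi => ?_
    rw [inner_smul_right, he.2 (by rintro rfl; exact hj hi), mul_zero]
  · rw [Finset.sum_congr rfl fun j hj => by rw [h j hj]]
    have := he.inner_sum a a J
    rw [inner_self_eq_norm_sq_to_K] at this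
    have h2 : ((‖∑ i ∈ J, a i • e i‖ ^ 2 : ℝ) : ℂ) = ((∑ j ∈ J, ‖a j‖ ^ 2 : ℝ) : ℂ) := by
      push_cast
      refine this.trans (Finset.sum_congr rfl fun j _ => ?_)
      rw [mul_comm, Complex.mul_conj, Complex.normSq_eq_norm_sq]
      push_cast; rfl
    exact_mod_cast h2.symm

theorem le_re_inner_diagOp_of_mem_span {e : ι → E} (he : Orthonormal ℂ e) {c : ι → ℝ}
    {J : Finset ι} {a : ℝ} (h : ∀ j ∈ J, a ≤ c j) {x : E}
    (hx : x ∈ Submodule.span ℂ (e '' J)) : a * ‖x‖ ^ 2 ≤ (⟪x, diagOp e c x⟫_ℂ).re := by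
  obtain ⟨h0, h1⟩ := inner_of_mem_span he hx
  rw [re_inner_diagOp, ← Finset.sum_subset (Finset.subset_univ J)
    (fun j _ hj => by simp [h0 j hj]), ← h1, Finset.mul_sum]
  exact Finset.sum_le_sum fun j hj => mul_le_mul_of_nonneg_right (h j hj) (sq_nonneg _)

theorem re_inner_diagOp_neg (e : ι → E) (c : ι → ℝ) (x : E) :
    (⟪x, diagOp e (-c) x⟫_ℂ).re = -(⟪x, diagOp e c x⟫_ℂ).re := by
  simp [re_inner_diagOp]

theorem re_inner_diagOp_le_of_mem_span {e : ι → E} (he : Orthonormal ℂ e) {c : ι → ℝ}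
    {J : Finset ι} {a : ℝ} (h : ∀ j ∈ J, c j ≤ a) {x : E}
    (hx : x ∈ Submodule.span ℂ (e '' J)) : (⟪x, diagOp e c x⟫_ℂ).re ≤ a * ‖x‖ ^ 2 := by
  have := le_re_inner_diagOp_of_mem_span he (c := -c) (a := -a)
    (fun j hj => neg_le_neg (h j hj)) hx
  rw [re_inner_diagOp_neg] at this
  linarith

/-- The family `e` need not be complete, so only Bessel's inequality is available; this is where `0
≤ a` enters. -/
theorem re_inner_diagOp_le_of_mem_orthogonal {e : ι → E} (he : Orthonormal ℂ e) {c : ι → ℝ}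
    {J : Finset ι} {a : ℝ} (ha : 0 ≤ a) (h : ∀ j ∉ J, c j ≤ a) {x : E}
    (hx : x ∈ (Submodule.span ℂ (e '' J))ᗮ) : (⟪x, diagOp e c x⟫_ℂ).re ≤ a * ‖x‖ ^ 2 := by
  rw [re_inner_diagOp]
  refine le_trans ?_ (mul_le_mul_of_nonneg_left (sum_sq_inner_le he x) ha)
  rw [Finset.mul_sum]
  refine Finset.sum_le_sum fun j _ => ?_
  by_cases hj : j ∈ J
  · simp [inner_eq_zero_of_mem_orthogonal_span hx hj]
  · exact mul_le_mul_of_nonneg_right (h j hj) (sq_nonneg _)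

theorem le_re_inner_diagOp_of_mem_orthogonal {e : ι → E} (he : Orthonormal ℂ e) {c : ι → ℝ}
    {J : Finset ι} {a : ℝ} (ha : a ≤ 0) (h : ∀ j ∉ J, a ≤ c j) {x : E}
    (hx : x ∈ (Submodule.span ℂ (e '' J))ᗮ) : a * ‖x‖ ^ 2 ≤ (⟪x, diagOp e c x⟫_ℂ).re := by
  have := re_inner_diagOp_le_of_mem_orthogonal he (c := -c) (a := -a) (by linarith)
    (fun j hj => neg_le_neg (h j hj)) hx
  rw [re_inner_diagOp_neg] at this
  linarith

variable [FiniteDimensional ℂ E] {d : ℕ} (hd : finrank ℂ E = d)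

include hd in
theorem exists_ne_zero_mem_inf {S S' : Submodule ℂ E} (h : d < finrank ℂ S + finrank ℂ S') :
    ∃ x ∈ S, x ∈ S' ∧ x ≠ 0 := by
  have h1 := Submodule.finrank_sup_add_finrank_inf_eq S S'
  have h2 : finrank ℂ (S ⊔ S' : Submodule ℂ E) ≤ d := hd ▸ Submodule.finrank_le _
  have h3 : (S ⊓ S') ≠ ⊥ := by
    intro h0
    rw [h0, finrank_bot] at h1
    omega
  obtain ⟨x, hx, hx0⟩ := Submodule.exists_mem_ne_zero_of_ne_bot h3
  exact ⟨x, hx.1, hx.2, hx0⟩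

omit [Fintype ι] in
include hd in
theorem finrank_orthogonal_span {e : ι → E} (he : Orthonormal ℂ e) (J : Finset ι) :
    finrank ℂ ((Submodule.span ℂ (e '' J))ᗮ : Submodule ℂ E) + J.card = d := by
  rw [← finrank_span_image he J, ← hd, add_comm]
  exact Submodule.finrank_add_finrank_orthogonal _

variable {T T' : E →ₗ[ℂ] E} (hT : T.IsSymmetric) (hT' : T'.IsSymmetric)

theorem eq_diagOp : T = diagOp (hT.eigenvectorBasis hd) (hT.eigenvalues hd) := by
  refine LinearMap.ext fun x => ?_
  conv_lhs => rw [← (hT.eigenvectorBasis hd).sum_repr' x]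
  simp only [map_sum, map_smul, hT.apply_eigenvectorBasis, diagOp_apply]
  exact Finset.sum_congr rfl fun j _ => smul_comm _ _ _

/-- One half of Courant–Fischer. With indices from `0`, the eigenvectors numbered `i` and beyond
span a space of dimension `d - i`, which must meet `S`; there the quadratic form is at most the
`i`-th eigenvalue times `‖x‖ ^ 2`. -/
theorem le_eigenvalues_of_submodule {S : Submodule ℂ E} {a : ℝ} (i : Fin d)
    (hS : (i : ℕ) < finrank ℂ S) (h : ∀ x ∈ S, a * ‖x‖ ^ 2 ≤ (⟪x, T x⟫_ℂ).re) :
    a ≤ hT.eigenvalues hd i := by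
  have hb := (hT.eigenvectorBasis hd).orthonormal
  have hc : finrank ℂ (Submodule.span ℂ (hT.eigenvectorBasis hd '' (Finset.Ici i : Finset _)))
      = d - i := by rw [finrank_span_image hb, Fin.card_Ici]
  obtain ⟨x, hx, hx', h0⟩ := exists_ne_zero_mem_inf hd (S := S)
    (S' := Submodule.span ℂ (hT.eigenvectorBasis hd '' (Finset.Ici i : Finset _)))
    (by rw [hc]; omega)
  have h1 := re_inner_diagOp_le_of_mem_span hb (c := hT.eigenvalues hd)
    (fun j hj => hT.eigenvalues_antitone hd (Finset.mem_Ici.1 hj)) hx'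
  rw [← eq_diagOp] at h1
  have : 0 < ‖x‖ ^ 2 := by positivity
  exact le_of_mul_le_mul_right ((h x hx).trans h1) this

theorem eigenvalues_le_of_submodule {S : Submodule ℂ E} {a : ℝ} (i : Fin d)
    (hS : d ≤ finrank ℂ S + i) (h : ∀ x ∈ S, (⟪x, T x⟫_ℂ).re ≤ a * ‖x‖ ^ 2) :
    hT.eigenvalues hd i ≤ a := by
  have hb := (hT.eigenvectorBasis hd).orthonormal
  have hc : finrank ℂ (Submodule.span ℂ (hT.eigenvectorBasis hd '' (Finset.Iic i : Finset _)))
      = i + 1 := by rw [finrank_span_image hb, Fin.card_Iic]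
  obtain ⟨x, hx, hx', h0⟩ := exists_ne_zero_mem_inf hd (S := S)
    (S' := Submodule.span ℂ (hT.eigenvectorBasis hd '' (Finset.Iic i : Finset _)))
    (by rw [hc]; omega)
  have h1 := le_re_inner_diagOp_of_mem_span hb (c := hT.eigenvalues hd)
    (fun j hj => hT.eigenvalues_antitone hd (Finset.mem_Iic.1 hj)) hx'
  rw [← eq_diagOp] at h1
  have : 0 < ‖x‖ ^ 2 := by positivity
  exact le_of_mul_le_mul_right (h1.trans (h x hx)) this

/-- Weyl's monotonicity principle. -/
theorem eigenvalues_le_add {t : ℝ}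
    (h : ∀ x, (⟪x, T x⟫_ℂ).re ≤ (⟪x, T' x⟫_ℂ).re + t * ‖x‖ ^ 2) (i : Fin d) :
    hT.eigenvalues hd i ≤ hT'.eigenvalues hd i + t := by
  have hb := (hT.eigenvectorBasis hd).orthonormal
  have := le_eigenvalues_of_submodule hd hT' (a := hT.eigenvalues hd i - t) i
    (S := Submodule.span ℂ (hT.eigenvectorBasis hd '' (Finset.Iic i : Finset _)))
    (by rw [finrank_span_image hb, Fin.card_Iic]; omega) (fun x hx => by
      have h1 := le_re_inner_diagOp_of_mem_span hb (c := hT.eigenvalues hd)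
        (fun j hj => hT.eigenvalues_antitone hd (Finset.mem_Iic.1 hj)) hx
      rw [← eq_diagOp] at h1
      linarith [h x])
  linarith

/-- The eigenvalues of two symmetric operators that are ordered up to a multiple of the identity
and positive operators of small trace. -/
theorem exists_abs_eigenvalues_sub_le {P Q : E →ₗ[ℂ] E} (hP : P.IsSymmetric) (hQ : Q.IsSymmetric)
    (hP0 : ∀ x, 0 ≤ (⟪x, P x⟫_ℂ).re) (hQ0 : ∀ x, 0 ≤ (⟪x, Q x⟫_ℂ).re) {t : ℝ}
    (h : ∀ x, (⟪x, T x⟫_ℂ).re ≤ (⟪x, T' x⟫_ℂ).re + (⟪x, P x⟫_ℂ).re + t * ‖x‖ ^ 2)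
    (h' : ∀ x, (⟪x, T' x⟫_ℂ).re ≤ (⟪x, T x⟫_ℂ).re + (⟪x, Q x⟫_ℂ).re + t * ‖x‖ ^ 2) :
    ∃ γ : Fin d → ℝ, (∀ i, 0 ≤ γ i) ∧ ∑ i, γ i = (P.trace ℂ E).re + (Q.trace ℂ E).re ∧
      ∀ i, |hT.eigenvalues hd i - hT'.eigenvalues hd i| ≤ γ i + t := by
  have hadd (A B : E →ₗ[ℂ] E) (x : E) :
      (⟪x, (A + B) x⟫_ℂ).re = (⟪x, A x⟫_ℂ).re + (⟪x, B x⟫_ℂ).re := by simp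
  have hs1 := (hT'.add hP).re_trace_eq_sum_eigenvalues hd
  have hs2 := (hT.add hQ).re_trace_eq_sum_eigenvalues hd
  have hs3 := hT.re_trace_eq_sum_eigenvalues hd
  have hs4 := hT'.re_trace_eq_sum_eigenvalues hd
  have k1 (i : Fin d) : hT'.eigenvalues hd i ≤ (hT'.add hP).eigenvalues hd i := by
    simpa using eigenvalues_le_add hd hT' (hT'.add hP) (t := 0)
      (fun x => by rw [hadd]; linarith [hP0 x]) i
  have k2 (i : Fin d) : hT.eigenvalues hd i ≤ (hT.add hQ).eigenvalues hd i := by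
    simpa using eigenvalues_le_add hd hT (hT.add hQ) (t := 0)
      (fun x => by rw [hadd]; linarith [hQ0 x]) i
  -- `γ i` is the sum of the two shifts of the `i`-th eigenvalue caused by adding `P` to `T'` and
  -- `Q` to `T`. Both shifts are nonnegative, and their totals are the traces of `P` and `Q`.
  refine ⟨fun i => ((hT'.add hP).eigenvalues hd i - hT'.eigenvalues hd i) +
    ((hT.add hQ).eigenvalues hd i - hT.eigenvalues hd i), fun i => ?_, ?_, fun i => ?_⟩
  · linarith [k1 i, k2 i]
  · simp only [map_add, RCLike.re_eq_complex_re] at hs1 hs2 hs3 hs4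
    rw [Finset.sum_add_distrib, Finset.sum_sub_distrib, Finset.sum_sub_distrib]
    linarith
  · have j1 := eigenvalues_le_add hd hT (hT'.add hP) (fun x => by rw [hadd]; exact h x) i
    have j2 := eigenvalues_le_add hd hT' (hT.add hQ) (fun x => by rw [hadd]; exact h' x) i
    have := k1 i
    have := k2 i
    rw [abs_le]
    constructor <;> linarith

/-- The extreme eigenvalues of `∑ sⱼ (|pⱼ⟩⟨pⱼ| - |nⱼ⟩⟨nⱼ|)`. -/
theorem eigenvalues_diagOp_symm {q : ℕ} {e : Fin q ⊕ Fin q → E} (he : Orthonormal ℂ e)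
    {s : Fin q → ℝ} (hs : Antitone s) (hs0 : ∀ i, 0 ≤ s i)
    (hTe : T = diagOp e (Sum.elim s (-s))) (i : Fin q) (j : Fin d) :
    ((j : ℕ) = i → hT.eigenvalues hd j = s i) ∧
    ((j : ℕ) + i + 1 = d → hT.eigenvalues hd j = -s i) := by
  have hi := hs0 i
  have c1 : ((Finset.Iic i).map (Function.Embedding.inl (α := Fin q) (β := Fin q))).card = i + 1 := by
    simp
  have c2 : ((Finset.Iio i).map (Function.Embedding.inl (α := Fin q) (β := Fin q))).card = i := by
    simp
  have c3 : ((Finset.Iic i).map (Function.Embedding.inr (α := Fin q) (β := Fin q))).card = i + 1 := by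
    simp
  have c4 : ((Finset.Iio i).map (Function.Embedding.inr (α := Fin q) (β := Fin q))).card = i := by
    simp
  -- The bounds for `s i` use the complement of the first `i` positive vectors and the span of the
  -- first `i + 1`; those for `-s i` use the negative vectors in the same way. Directions outside
  -- `e` contribute `0`, which lies between `-s i` and `s i`.
  constructor <;> intro hij <;> apply le_antisymm
  · refine eigenvalues_le_of_submodule hd hT j ?_ (fun x hx => hTe ▸
      re_inner_diagOp_le_of_mem_orthogonal he (J := (Finset.Iio i).map .inl) hi ?_ hx)
    · have := finrank_orthogonal_span hd he ((Finset.Iio i).map .inl)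
      omega
    · rintro (k | k) hk
      · exact hs (not_lt.1 (by simpa using hk))
      · simpa using (by linarith [hs0 k] : -s k ≤ s i)
  · refine le_eigenvalues_of_submodule hd hT j ?_ (fun x hx => hTe ▸
      le_re_inner_diagOp_of_mem_span he (J := (Finset.Iic i).map .inl) ?_ hx)
    · rw [finrank_span_image he, c1]; omega
    · rintro (k | k) hk
      · exact hs (by simpa using hk)
      · simp at hk
  · refine eigenvalues_le_of_submodule hd hT j ?_ (fun x hx => hTe ▸
      re_inner_diagOp_le_of_mem_span he (J := (Finset.Iic i).map .inr) ?_ hx)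
    · rw [finrank_span_image he, c3]; omega
    · rintro (k | k) hk
      · simp at hk
      · exact neg_le_neg (hs (by simpa using hk))
  · refine le_eigenvalues_of_submodule hd hT j ?_ (fun x hx => hTe ▸
      le_re_inner_diagOp_of_mem_orthogonal he (J := (Finset.Iio i).map .inr) (by linarith) ?_ hx)
    · have := finrank_orthogonal_span hd he ((Finset.Iio i).map .inr)
      omega
    · rintro (k | k) hk
      · simpa using (by linarith [hs0 k] : -s i ≤ s k)
      · exact neg_le_neg (hs (not_lt.1 (by simpa using hk)))

end Spectral

/-! ### Singular values as eigenvalues of the self-adjoint dilation. -/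

section Dilation

variable {U V : Type*} [NormedAddCommGroup U] [InnerProductSpace ℂ U] [FiniteDimensional ℂ U]
  [NormedAddCommGroup V] [InnerProductSpace ℂ V] [FiniteDimensional ℂ V]

/-- The self-adjoint dilation `(x, y) ↦ (T y, T* x)` of `T`. -/
noncomputable def dilation (T : V →ₗ[ℂ] U) : WithLp 2 (U × V) →ₗ[ℂ] WithLp 2 (U × V) where
  toFun z := WithLp.toLp 2 (T z.snd, T.adjoint z.fst)
  map_add' x y := by simp [← WithLp.toLp_add]
  map_smul' c x := by simp [← WithLp.toLp_smul]

theorem dilation_apply (T : V →ₗ[ℂ] U) (z : WithLp 2 (U × V)) :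
    dilation T z = WithLp.toLp 2 (T z.snd, T.adjoint z.fst) := rfl

theorem isSymmetric_dilation (T : V →ₗ[ℂ] U) : (dilation T).IsSymmetric := by
  intro x y
  simp [dilation_apply, WithLp.prod_inner_apply, LinearMap.adjoint_inner_left,
    LinearMap.adjoint_inner_right, add_comm]

theorem dilation_sub (T T' : V →ₗ[ℂ] U) : dilation (T - T') = dilation T - dilation T' := by
  refine LinearMap.ext fun x => ?_
  simp [dilation_apply, ← WithLp.toLp_sub]

/-- The unit eigenvectors `(uⱼ, ± vⱼ) / √2` of the dilation. -/
noncomputable def dilationVec {q : ℕ} (u : Fin q → U) (v : Fin q → V) :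
    Fin q ⊕ Fin q → WithLp 2 (U × V) :=
  Sum.elim (fun j => (((√2)⁻¹ : ℝ) : ℂ) • WithLp.toLp 2 (u j, v j))
    (fun j => (((√2)⁻¹ : ℝ) : ℂ) • WithLp.toLp 2 (u j, -v j))

theorem inv_sqrt_two_mul_self : (((√2)⁻¹ : ℝ) : ℂ) * (((√2)⁻¹ : ℝ) : ℂ) = 2⁻¹ := by
  rw [← Complex.ofReal_mul, ← mul_inv, Real.mul_self_sqrt (by norm_num)]
  norm_num

omit [FiniteDimensional ℂ U] [FiniteDimensional ℂ V] in
theorem orthonormal_dilationVec {q : ℕ} {u : Fin q → U} {v : Fin q → V} (hu : Orthonormal ℂ u)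
    (hv : Orthonormal ℂ v) : Orthonormal ℂ (dilationVec u v) := by
  rw [orthonormal_iff_ite] at *
  rintro (i | i) (j | j) <;>
  simp only [dilationVec, Sum.elim_inl, Sum.elim_inr, inner_smul_left, inner_smul_right,
    Complex.conj_ofReal, WithLp.prod_inner_apply, hu, hv, inner_neg_left, inner_neg_right,
    ← mul_assoc, inv_sqrt_two_mul_self, Sum.inl.injEq, Sum.inr.injEq, reduceCtorEq] <;>
  split_ifs <;> first | contradiction | norm_num

theorem dilation_eq_diagOp {q : ℕ} {u : Fin q → U} {v : Fin q → V} {s : Fin q → ℝ}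
    {T : V →ₗ[ℂ] U} (hT : ∀ y, T y = ∑ j, (s j : ℂ) • ⟪v j, y⟫_ℂ • u j) :
    dilation T = diagOp (dilationVec u v) (Sum.elim s (-s)) := by
  have hT' (x : U) : T.adjoint x = ∑ j, (s j : ℂ) • ⟪u j, x⟫_ℂ • v j := by
    refine ext_inner_right ℂ fun y => ?_
    rw [LinearMap.adjoint_inner_left, hT, inner_sum, sum_inner]
    refine Finset.sum_congr rfl fun j _ => ?_
    simp only [inner_smul_left, inner_smul_right, Complex.conj_ofReal, inner_conj_symm]
    ring
  refine LinearMap.ext fun z => ?_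
  have key (j : Fin q) : ((s j : ℂ) • WithLp.toLp 2 (⟪v j, z.snd⟫_ℂ • u j, ⟪u j, z.fst⟫_ℂ • v j) :
      WithLp 2 (U × V)) =
      (s j : ℂ) • ⟪dilationVec u v (.inl j), z⟫_ℂ • dilationVec u v (.inl j) +
      ((-s j : ℝ) : ℂ) • ⟪dilationVec u v (.inr j), z⟫_ℂ • dilationVec u v (.inr j) := by
    simp only [dilationVec, Sum.elim_inl, Sum.elim_inr, inner_smul_left, Complex.conj_ofReal,
      WithLp.prod_inner_apply, inner_neg_left, smul_smul, Complex.ofReal_neg]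
    have h := inv_sqrt_two_mul_self
    set r := (((√2)⁻¹ : ℝ) : ℂ)
    refine WithLp.ofLp_injective 2 (Prod.ext ?_ ?_)
    · simp only [WithLp.ofLp_add, WithLp.ofLp_smul, Prod.fst_add, Prod.smul_fst, ← add_smul,
        smul_smul]
      congr 1
      rw [← WithLp.snd]
      linear_combination (-2 * (s j : ℂ) * ⟪v j, z.snd⟫_ℂ) * h
    · simp only [WithLp.ofLp_add, WithLp.ofLp_smul, Prod.snd_add, Prod.smul_snd, ← add_smul,
        smul_smul, smul_neg, ← neg_smul]
      congr 1
      rw [← WithLp.fst]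
      linear_combination (-2 * (s j : ℂ) * ⟪u j, z.fst⟫_ℂ) * h
  rw [diagOp_apply, Fintype.sum_sum_type, ← Finset.sum_add_distrib]
  simp only [Sum.elim_inl, Sum.elim_inr, Pi.neg_apply, ← key]
  rw [dilation_apply, hT, hT']
  refine WithLp.ofLp_injective 2 (Prod.ext ?_ ?_)
  · simp [WithLp.ofLp_sum, Prod.fst_sum]
  · simp [WithLp.ofLp_sum, Prod.snd_sum]

theorem finrank_withLp_prod {m n : ℕ} (hm : finrank ℂ U = m) (hn : finrank ℂ V = n) :
    finrank ℂ (WithLp 2 (U × V)) = m + n := by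
  rw [(WithLp.linearEquiv 2 ℂ (U × V)).finrank_eq, finrank_prod, hm, hn]

/-- Mirsky's inequality for the Ky Fan norms. -/
theorem sum_abs_sub_le {m n q : ℕ} (hm : finrank ℂ U = m) (hn : finrank ℂ V = n)
    (hqm : q ≤ m) (hqn : q ≤ n) {A B : V →ₗ[ℂ] U}
    {u u' u'' : Fin q → U} {v v' v'' : Fin q → V} {a b w : Fin q → ℝ}
    (hu : Orthonormal ℂ u) (hv : Orthonormal ℂ v) (hu' : Orthonormal ℂ u')
    (hv' : Orthonormal ℂ v') (hu'' : Orthonormal ℂ u'') (hv'' : Orthonormal ℂ v'')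
    (ha : Antitone a) (ha0 : ∀ i, 0 ≤ a i) (hb : Antitone b) (hb0 : ∀ i, 0 ≤ b i)
    (hw0 : ∀ i, 0 ≤ w i)
    (hA : ∀ y, A y = ∑ j, (a j : ℂ) • ⟪v j, y⟫_ℂ • u j)
    (hB : ∀ y, B y = ∑ j, (b j : ℂ) • ⟪v' j, y⟫_ℂ • u' j)
    (hAB : ∀ y, (A - B) y = ∑ j, (w j : ℂ) • ⟪v'' j, y⟫_ℂ • u'' j)
    (S : Finset (Fin q)) {t : ℝ} (ht : 0 ≤ t) :
    ∑ i ∈ S, |a i - b i| ≤ S.card * t + ∑ i, max (w i - t) 0 := by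
  have hd := finrank_withLp_prod hm hn
  have heA := orthonormal_dilationVec hu hv
  have heB := orthonormal_dilationVec hu' hv'
  have heC := orthonormal_dilationVec hu'' hv''
  set e := dilationVec u'' v''
  -- The excess of `w` over the threshold `t`. The difference of the dilations is at most `t` plus a
  -- positive operator with weights `c` on the vectors `(u'', v'') / √2`; its negative is at most
  -- `t` plus the same on `(u'', -v'') / √2`. Each positive operator has trace `∑ i, c i`.
  set c : Fin q → ℝ := fun i => max (w i - t) 0
  have hc0 (i) : 0 ≤ c i := le_max_right _ _
  have hcw (i) : w i ≤ c i + t := by linarith [le_max_left (w i - t) 0]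
  have hform (x) : (⟪x, dilation A x⟫_ℂ).re - (⟪x, dilation B x⟫_ℂ).re =
      (⟪x, diagOp e (Sum.elim w (-w)) x⟫_ℂ).re := by
    rw [← dilation_eq_diagOp hAB, dilation_sub, LinearMap.sub_apply, inner_sub_right,
      Complex.sub_re]
  have hpos (c' : Fin q ⊕ Fin q → ℝ) (h : ∀ j, 0 ≤ c' j) (x) : 0 ≤ (⟪x, diagOp e c' x⟫_ℂ).re := by
    rw [re_inner_diagOp]
    exact Finset.sum_nonneg fun j _ => mul_nonneg (h j) (sq_nonneg _)
  have hle (c' c'' : Fin q ⊕ Fin q → ℝ) (h : ∀ j, c' j ≤ c'' j + t) (x) :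
      (⟪x, diagOp e c' x⟫_ℂ).re ≤ (⟪x, diagOp e c'' x⟫_ℂ).re + t * ‖x‖ ^ 2 := by
    refine le_trans ?_ (add_le_add_right (mul_le_mul_of_nonneg_left (sum_sq_inner_le heC x) ht) _)
    rw [re_inner_diagOp, re_inner_diagOp, Finset.mul_sum, ← Finset.sum_add_distrib]
    refine Finset.sum_le_sum fun j _ => ?_
    rw [← add_mul]
    exact mul_le_mul_of_nonneg_right (h j) (sq_nonneg _)
  obtain ⟨γ, hγ0, hγ, hγle⟩ := exists_abs_eigenvalues_sub_le hd (isSymmetric_dilation A)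
    (isSymmetric_dilation B) (isSymmetric_diagOp e (Sum.elim c 0))
    (isSymmetric_diagOp e (Sum.elim 0 c))
    (hpos _ (by rintro (j | j); exacts [hc0 j, le_rfl]))
    (hpos _ (by rintro (j | j); exacts [le_rfl, hc0 j])) (t := t)
    (fun x => by
      have := hle (Sum.elim w (-w)) (Sum.elim c 0) (by
        rintro (j | j)
        · exact hcw j
        · simp; linarith [hw0 j]) x
      linarith [hform x])
    (fun x => by
      have := hle (-Sum.elim w (-w)) (Sum.elim 0 c) (by
        rintro (j | j)
        · simp; linarith [hw0 j]
        · simpa using hcw j) x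
      rw [re_inner_diagOp_neg] at this
      linarith [hform x])
  rw [re_trace_diagOp heC, re_trace_diagOp heC] at hγ
  simp only [Fintype.sum_sum_type, Sum.elim_inl, Sum.elim_inr, Pi.zero_apply,
    Finset.sum_const_zero, add_zero, zero_add] at hγ
  -- The positions of the `i`-th singular value and of its negative in the ordered spectrum. They
  -- are all distinct because `q ≤ m` and `q ≤ n`, so each `|a i - b i|` is counted twice without
  -- repeating any `γ`.
  let φ : Fin q ⊕ Fin q → Fin (m + n) := Sum.elim (fun i => ⟨i, by omega⟩)
    (fun i => ⟨m + n - 1 - i, by omega⟩)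
  have hφ : Function.Injective φ := by
    rintro (i | i) (j | j) h <;> simp only [φ, Sum.elim_inl, Sum.elim_inr, Fin.mk.injEq] at h
    · rw [Fin.ext h]
    · omega
    · omega
    · congr 1; ext; omega
  have hbd (i : Fin q) : 2 * |a i - b i| ≤ γ (φ (.inl i)) + γ (φ (.inr i)) + 2 * t := by
    have eA := eigenvalues_diagOp_symm hd (isSymmetric_dilation A) heA ha ha0
      (dilation_eq_diagOp hA) i
    have eB := eigenvalues_diagOp_symm hd (isSymmetric_dilation B) heB hb hb0
      (dilation_eq_diagOp hB) i
    have h1 := hγle (φ (.inl i))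
    have h2 := hγle (φ (.inr i))
    rw [(eA _).1 rfl, (eB _).1 rfl] at h1
    have hh : ((φ (.inr i) : Fin (m + n)) : ℕ) + i + 1 = m + n := by
      simp only [φ, Sum.elim_inr]; omega
    rw [(eA _).2 hh, (eB _).2 hh, neg_sub_neg, abs_sub_comm] at h2
    linarith
  have hsum : ∑ i ∈ S, (γ (φ (.inl i)) + γ (φ (.inr i))) ≤ ∑ i, γ i := by
    refine (Finset.sum_le_univ_sum_of_nonneg fun i => add_nonneg (hγ0 _) (hγ0 _)).trans ?_
    rw [Finset.sum_add_distrib, ← Fintype.sum_sum_type (fun i => γ (φ i)),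
      ← Finset.sum_image (f := γ) hφ.injOn]
    exact Finset.sum_le_univ_sum_of_nonneg hγ0
  have h2 := Finset.sum_le_sum fun i (_ : i ∈ S) => hbd i
  rw [← Finset.mul_sum, Finset.sum_add_distrib, Finset.sum_const, nsmul_eq_mul] at h2
  linarith

/-- Both families list the top `q` eigenvalues of the same dilation. -/
theorem singularFamily_unique {m n q : ℕ} (hm : finrank ℂ U = m) (hn : finrank ℂ V = n)
    (hqm : q ≤ m) {A : V →ₗ[ℂ] U} {u u' : Fin q → U} {v v' : Fin q → V} {a b : Fin q → ℝ}
    (hu : Orthonormal ℂ u) (hv : Orthonormal ℂ v) (hu' : Orthonormal ℂ u')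
    (hv' : Orthonormal ℂ v')
    (ha : Antitone a) (ha0 : ∀ i, 0 ≤ a i) (hb : Antitone b) (hb0 : ∀ i, 0 ≤ b i)
    (hA : ∀ y, A y = ∑ j, (a j : ℂ) • ⟪v j, y⟫_ℂ • u j)
    (hB : ∀ y, A y = ∑ j, (b j : ℂ) • ⟪v' j, y⟫_ℂ • u' j) : a = b := by
  ext i
  have hd := finrank_withLp_prod hm hn
  have eA := eigenvalues_diagOp_symm hd (isSymmetric_dilation A) (orthonormal_dilationVec hu hv)
    ha ha0 (dilation_eq_diagOp hA) i ⟨i, by omega⟩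
  have eB := eigenvalues_diagOp_symm hd (isSymmetric_dilation A) (orthonormal_dilationVec hu' hv')
    hb hb0 (dilation_eq_diagOp hB) i ⟨i, by omega⟩
  rw [← eA.1 rfl, ← eB.1 rfl]

/-- For an eigenbasis `b` of `T* T`, the vectors `T (b j)` are orthogonal of norm equal to the
singular values. The nonzero ones, normalized, extend to an orthonormal basis. -/
theorem exists_singular_bases {m n : ℕ} (hm : finrank ℂ U = m) (hn : finrank ℂ V = n)
    (T : V →ₗ[ℂ] U) : ∃ (c : OrthonormalBasis (Fin m) ℂ U) (b : OrthonormalBasis (Fin n) ℂ V),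
      ∀ j : Fin n, T (b j) = if h : (j : ℕ) < m then (T.singularValues j : ℂ) • c ⟨j, h⟩ else 0 := by
  classical
  have hsym := T.isSymmetric_adjoint_comp_self
  set b := hsym.eigenvectorBasis hn
  have hin (i j : Fin n) : ⟪T (b i), T (b j)⟫_ℂ =
      if i = j then ((T.singularValues j ^ 2 : ℝ) : ℂ) else 0 := by
    rw [← LinearMap.adjoint_inner_right, ← LinearMap.comp_apply, hsym.apply_eigenvectorBasis hn j,
      inner_smul_right, orthonormal_iff_ite.1 b.orthonormal i j, T.sq_singularValues_fin hn]
    split_ifs <;> simp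
  have hz (j : Fin n) (h : T.singularValues j = 0) : T (b j) = 0 := by
    have := hin j j
    simpa [h] using this
  let f : Fin m → U := fun j =>
    if h : (j : ℕ) < n then ((T.singularValues j : ℂ))⁻¹ • T (b ⟨j, h⟩) else 0
  let S : Set (Fin m) := {j | (j : ℕ) < n ∧ T.singularValues j ≠ 0}
  have hf : Orthonormal ℂ (S.domRestrict f) := by
    rw [orthonormal_iff_ite]
    rintro ⟨i, hi, hi0⟩ ⟨j, hj, hj0⟩
    have hj0' : (T.singularValues j : ℂ) ≠ 0 := by exact_mod_cast hj0
    simp only [Set.domRestrict_apply, f, dif_pos hi, dif_pos hj, inner_smul_left, inner_smul_right,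
      hin, Fin.mk.injEq, Subtype.mk.injEq, Fin.val_inj]
    split_ifs with h
    · subst h
      simp only [map_inv₀, Complex.conj_ofReal, Complex.ofReal_pow]
      field_simp
    · simp
  obtain ⟨c, hc⟩ := hf.exists_orthonormalBasis_extension_of_card_eq (by simp [hm])
  refine ⟨c, b, fun j => ?_⟩
  by_cases h0 : T.singularValues j = 0
  · rw [hz j h0]; simp [h0]
  · have hj : (j : ℕ) < m := by
      by_contra! h
      refine h0 (T.singularValues_eq_zero_iff_le_finrank_range.2 (le_trans ?_ h))
      exact hm ▸ Submodule.finrank_le _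
    have hne : (T.singularValues j : ℂ) ≠ 0 := by exact_mod_cast h0
    rw [dif_pos hj, hc ⟨j, hj⟩ ⟨j.2, h0⟩]
    simp [f, smul_smul, hne]

end Dilation

/-! ### Symmetric gauge functions and weak majorization. -/

section Gauge

/-- Abel summation in inductive form. The lower bound `c` is carried so that the induction
hypothesis can be used with the last weight; nonnegativity of the total then allows replacing that
weight by `c`. -/
theorem mul_sum_le_sum_mul_of_partial_sums : ∀ {q : ℕ} {p x : Fin q → ℝ}, Antitone p →
    (∀ j : ℕ, j ≤ q → 0 ≤ ∑ i : Fin q, if (i : ℕ) < j then x i else 0) →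
    ∀ c : ℝ, (∀ i, c ≤ p i) → c * ∑ i, x i ≤ ∑ i, p i * x i := by
  intro q
  induction q with
  | zero => intros; simp
  | succ q ih =>
    intro p x hp hx c hc
    have h0 : 0 ≤ ∑ i, x i := by
      refine (hx (q + 1) le_rfl).trans_eq (Finset.sum_congr rfl fun i _ => if_pos i.2)
    have h1 := ih (p := fun i => p i.castSucc) (x := fun i => x i.castSucc)
      (fun i j h => hp (Fin.castSucc_le_castSucc_iff.2 h))
      (fun j hj => by
        have := hx j (by omega)
        rw [Fin.sum_univ_castSucc] at this
        simpa [not_lt.2 hj] using this)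
      (p (Fin.last q)) (fun i => hp (Fin.le_last _))
    have h2 := mul_le_mul_of_nonneg_right (hc (Fin.last q)) h0
    rw [Fin.sum_univ_castSucc] at h0 h2 ⊢
    rw [Fin.sum_univ_castSucc]
    linarith

theorem exists_perm_antitone {q : ℕ} (p : Fin q → ℝ) :
    ∃ τ : Equiv.Perm (Fin q), Antitone (fun i => p (τ i)) :=
  ⟨Tuple.sort (-p), fun _ _ h => neg_le_neg_iff.1 (Tuple.monotone_sort (-p) h)⟩

/-- Hahn–Banach: a norming functional at `z`, written in coordinates. -/
theorem exists_dual_eq_seminorm {q : ℕ} (Φ : Seminorm ℝ (Fin q → ℝ)) (z : Fin q → ℝ) :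
    ∃ φ : Fin q → ℝ, ∑ i, φ i * z i = Φ z ∧ ∀ x, ∑ i, φ i * x i ≤ Φ x := by
  suffices ∃ g : (Fin q → ℝ) →ₗ[ℝ] ℝ, g z = Φ z ∧ ∀ x, g x ≤ Φ x by
    obtain ⟨g, hg, hle⟩ := this
    have h (x) : ∑ i, g (Pi.single i 1) * x i = g x := by
      conv_rhs => rw [LinearMap.pi_apply_eq_sum_univ g x]
      refine Finset.sum_congr rfl fun i _ => ?_
      rw [smul_eq_mul, mul_comm]
      congr 2
      ext j
      simp [Pi.single_apply, eq_comm]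
    exact ⟨fun i => g (Pi.single i 1), by rw [h, hg], fun x => by rw [h]; exact hle x⟩
  rcases eq_or_ne z 0 with rfl | hz
  · exact ⟨0, by simp, fun x => by simp⟩
  · let f : (Fin q → ℝ) →ₗ.[ℝ] ℝ := LinearPMap.mkSpanSingleton z (Φ z) hz
    obtain ⟨g, hg, hle⟩ := exists_extension_of_le_sublinear f Φ (fun c hc x => by rw [map_smul_eq_mul, Real.norm_of_nonneg hc.le]) (map_add_le_add Φ) (by
        rintro ⟨x, hx⟩
        obtain ⟨c, rfl⟩ := Submodule.mem_span_singleton.1 hx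
        have : f ⟨c • z, hx⟩ = c • Φ z :=
          LinearPMap.mkSpanSingleton'_apply _ _ _ _ _
        rw [this, map_smul_eq_mul, smul_eq_mul]
        exact mul_le_mul_of_nonneg_right (le_abs_self c) (apply_nonneg Φ z))
    refine ⟨g, ?_, hle⟩
    have hmem : z ∈ f.domain :=
      Submodule.mem_span_singleton_self z
    rw [hg ⟨z, hmem⟩]
    exact LinearPMap.mkSpanSingleton'_apply_self _ _ _ _

/-- A symmetric gauge function is monotone for weak majorization. -/
theorem IsSymmetricGauge.le_of_sum_le {q : ℕ} {Φ : Seminorm ℝ (Fin q → ℝ)}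
    (hΦ : IsSymmetricGauge Φ) {z w : Fin q → ℝ} (hw0 : ∀ i, 0 ≤ w i)
    (h : ∀ S : Finset (Fin q), ∑ i ∈ S, |z i| ≤ ∑ i : Fin q, if (i : ℕ) < S.card then w i else 0) :
    Φ z ≤ Φ w := by
  obtain ⟨φ, hz, hφ⟩ := exists_dual_eq_seminorm Φ z
  obtain ⟨τ, hτ⟩ := exists_perm_antitone (fun i => |φ i|)
  obtain ⟨ρ, hρ⟩ := exists_perm_antitone (fun i => |z i|)
  set ε : Fin q → ℝ := fun i => if φ i < 0 then -1 else 1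
  have hε (i) : |ε i| = 1 := by simp only [ε]; split_ifs <;> simp
  have hεφ (i) : φ i * ε i = |φ i| := by
    simp only [ε]
    split_ifs with h
    · rw [abs_of_neg h]; ring
    · rw [abs_of_nonneg (not_lt.1 h)]; ring
  -- The hypothesis on the `j` indices with largest `|z i|` says that the partial sums of `w - |z ∘
  -- ρ|` are nonnegative. Together with the rearrangement inequality this replaces `z` by `w`; a
  -- signed permutation, harmless for `Φ`, then restores `φ`.
  have habel : 0 * ∑ i, (w i - |z (ρ i)|) ≤ ∑ i, |φ (τ i)| * (w i - |z (ρ i)|) := by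
    refine mul_sum_le_sum_mul_of_partial_sums hτ (fun j hj => ?_) 0 fun i => abs_nonneg _
    have hS := h ((Finset.univ.filter fun i : Fin q => (i : ℕ) < j).map ρ.toEmbedding)
    rw [Finset.sum_map, Finset.card_map, Fin.card_filter_val_lt, min_eq_right hj,
      Finset.sum_filter] at hS
    rw [← sub_nonneg, ← Finset.sum_sub_distrib] at hS
    refine hS.trans_eq (Finset.sum_congr rfl fun i _ => ?_)
    split_ifs <;> simp
  calc Φ z = ∑ i, φ i * z i := hz.symm
    _ ≤ ∑ i, |φ i| * |z i| := Finset.sum_le_sum fun i _ => by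
        rw [← abs_mul]; exact le_abs_self _
    _ = ∑ i, |φ (τ i)| * |z (ρ ((τ.trans ρ.symm) i))| := by
        rw [← Equiv.sum_comp τ]; simp
    _ ≤ ∑ i, |φ (τ i)| * |z (ρ i)| := (hτ.monovary hρ).sum_mul_comp_perm_le_sum_mul
    _ ≤ ∑ i, |φ (τ i)| * w i := by
        simp only [mul_sub, Finset.sum_sub_distrib] at habel
        linarith
    _ = ∑ i, φ i * (ε i * w (τ.symm i)) := by
        rw [← Equiv.sum_comp τ (fun i => φ i * (ε i * w (τ.symm i)))]
        refine Finset.sum_congr rfl fun i _ => ?_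
        rw [← mul_assoc, hεφ, Equiv.symm_apply_apply]
    _ ≤ Φ (fun i => ε i * w (τ.symm i)) := hφ _
    _ = Φ w := by
        rw [hΦ.map_abs_perm τ]
        congr 1
        ext i
        rw [abs_mul, hε, one_mul, Equiv.symm_apply_apply, abs_of_nonneg (hw0 i)]

end Gauge

/-! ### Rectangular diagonal matrices, with permutations and signs realized by unitaries. -/

section Diag

variable {m n : ℕ}

/-- The `m × n` matrix with diagonal `x`. -/
noncomputable def diagMat (m n : ℕ) (x : Fin (min m n) → ℝ) : Matrix (Fin m) (Fin n) ℂ :=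
  blockDiag m n (min m n) fun i => if h : i < min m n then x ⟨i, h⟩ else 0

/-- The inclusion of the diagonal indices into the rows. -/
def rowEmb (m n : ℕ) : Fin (min m n) ↪ Fin m := Fin.castLEEmb (min_le_left m n)

/-- The inclusion of the diagonal indices into the columns. -/
def colEmb (m n : ℕ) : Fin (min m n) ↪ Fin n := Fin.castLEEmb (min_le_right m n)

theorem diagMat_apply (x : Fin (min m n) → ℝ) (a : Fin m) (b : Fin n) :
    diagMat m n x a b = ∑ i, if a = rowEmb m n i ∧ b = colEmb m n i then (x i : ℂ) else 0 := by
  by_cases h : (a : ℕ) = b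
  · have ha : (a : ℕ) < min m n := by omega
    rw [Finset.sum_eq_single ⟨a, ha⟩]
    · rw [if_pos ⟨Fin.ext rfl, Fin.ext h.symm⟩]
      have ha' : (a : ℕ) < n := by omega
      simp [diagMat, blockDiag, ← h, ha']
    · rintro i - hi
      rw [if_neg]
      rintro ⟨rfl, -⟩
      exact hi rfl
    · simp
  · rw [Finset.sum_eq_zero]
    · simp [diagMat, blockDiag, h]
    · rintro i -
      rw [if_neg]
      rintro ⟨rfl, rfl⟩
      exact h rfl

theorem blockDiag_eq_diagMat (r : ℕ) (f : ℕ → ℝ) :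
    blockDiag m n r f = diagMat m n fun i => if (i : ℕ) < r then f i else 0 := by
  ext a b
  simp only [diagMat, blockDiag, Matrix.of_apply]
  by_cases h : (a : ℕ) = b
  · have ha : (a : ℕ) < min m n := by omega
    by_cases hr : (a : ℕ) < r <;> simp [← h, ha, hr]
  · simp [h]

theorem diagMat_add (x y : Fin (min m n) → ℝ) :
    diagMat m n (x + y) = diagMat m n x + diagMat m n y := by
  ext a b
  simp only [Matrix.add_apply, diagMat_apply, ← Finset.sum_add_distrib]
  refine Finset.sum_congr rfl fun i _ => ?_
  split_ifs <;> simp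

theorem diagMat_smul (c : ℝ) (x : Fin (min m n) → ℝ) :
    diagMat m n (c • x) = (c : ℂ) • diagMat m n x := by
  ext a b
  simp only [Matrix.smul_apply, diagMat_apply, Finset.smul_sum]
  refine Finset.sum_congr rfl fun i _ => ?_
  split_ifs <;> simp

theorem diagMat_sub (x y : Fin (min m n) → ℝ) :
    diagMat m n (x - y) = diagMat m n x - diagMat m n y := by
  rw [eq_sub_iff_add_eq, ← diagMat_add, sub_add_cancel]

theorem diagMat_injective : Function.Injective (diagMat m n) := by
  intro x y h
  ext i
  have := congr_fun₂ h (rowEmb m n i) (colEmb m n i)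
  simpa [diagMat_apply] using this

theorem diagMat_submatrix (σ : Equiv.Perm (Fin (min m n))) (x : Fin (min m n) → ℝ) :
    (diagMat m n x).submatrix (σ.viaFintypeEmbedding (rowEmb m n))
      (σ.viaFintypeEmbedding (colEmb m n)) = diagMat m n fun i => x (σ i) := by
  ext a b
  simp only [Matrix.submatrix_apply, diagMat_apply]
  rw [← Equiv.sum_comp σ]
  simp only [← Equiv.Perm.viaFintypeEmbedding_apply_image, EmbeddingLike.apply_eq_iff_eq]

theorem permMatrix_mem_unitaryGroup {l : ℕ} (σ : Equiv.Perm (Fin l)) :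
    σ.permMatrix ℂ ∈ Matrix.unitaryGroup (Fin l) ℂ := by
  rw [Matrix.mem_unitaryGroup_iff, Matrix.star_eq_conjTranspose, Matrix.conjTranspose_permMatrix,
    ← Matrix.permMatrix_mul]
  simp

theorem exists_unitary_mul_diagMat_mul (σ : Equiv.Perm (Fin (min m n))) (x : Fin (min m n) → ℝ) :
    ∃ P ∈ Matrix.unitaryGroup (Fin m) ℂ, ∃ Q ∈ Matrix.unitaryGroup (Fin n) ℂ,
      P * diagMat m n x * Q = diagMat m n fun i => |x (σ i)| := by
  -- Signs are read off after the permutation; columns beyond the diagonal get `1` to keep the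
  -- matrix unitary.
  let ε : Fin n → ℂ := fun b => if h : (b : ℕ) < min m n then
    (if x (σ ⟨b, h⟩) < 0 then -1 else 1) else 1
  have hε : Matrix.diagonal ε ∈ Matrix.unitaryGroup (Fin n) ℂ := by
    rw [Matrix.mem_unitaryGroup_iff, Matrix.star_eq_conjTranspose, Matrix.diagonal_conjTranspose,
      Matrix.diagonal_mul_diagonal, ← Matrix.diagonal_one]
    congr 1
    ext b
    simp only [ε, Pi.star_apply]
    split_ifs <;> simp
  refine ⟨(σ.viaFintypeEmbedding (rowEmb m n)).permMatrix ℂ, permMatrix_mem_unitaryGroup _,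
    (σ.viaFintypeEmbedding (colEmb m n))⁻¹.permMatrix ℂ * Matrix.diagonal ε,
    mul_mem (permMatrix_mem_unitaryGroup _) hε, ?_⟩
  have h1 : (σ.viaFintypeEmbedding (rowEmb m n)).permMatrix ℂ * diagMat m n x *
      (σ.viaFintypeEmbedding (colEmb m n))⁻¹.permMatrix ℂ = diagMat m n fun i => x (σ i) := by
    rw [← diagMat_submatrix, Equiv.Perm.permMatrix, Equiv.Perm.permMatrix,
      PEquiv.toMatrix_toPEquiv_mul, PEquiv.mul_toMatrix_toPEquiv, Matrix.submatrix_submatrix]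
    rfl
  rw [← Matrix.mul_assoc, h1]
  ext a b
  rw [Matrix.mul_diagonal, diagMat_apply, diagMat_apply, Finset.sum_mul]
  refine Finset.sum_congr rfl fun i _ => ?_
  split_ifs with h
  · have hb : (b : ℕ) = i := by rw [h.2]; rfl
    have hb' : (b : ℕ) < min m n := hb ▸ i.2
    have hi : (⟨b, hb'⟩ : Fin (min m n)) = i := Fin.ext hb
    simp only [ε, dif_pos hb', hi]
    split_ifs with h0
    · rw [abs_of_neg h0]; push_cast; ring
    · rw [abs_of_nonneg (not_lt.1 h0), mul_one]
  · simp

end Diag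

/-! ### Singular value decompositions, Mirsky's inequality and the minimization. -/

section Matrix

variable {m n : ℕ}

/-- The columns of a matrix as vectors of a Euclidean space. -/
noncomputable def colVec {l : ℕ} (V : Matrix (Fin l) (Fin l) ℂ) (j : Fin l) :
    EuclideanSpace ℂ (Fin l) :=
  WithLp.toLp 2 fun a => V a j

theorem inner_colVec {l : ℕ} (V : Matrix (Fin l) (Fin l) ℂ) (j : Fin l)
    (y : EuclideanSpace ℂ (Fin l)) : ⟪colVec V j, y⟫_ℂ = ∑ b, star (V b j) * y b := by
  simp [colVec, PiLp.inner_apply, mul_comm]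

theorem orthonormal_colVec {l : ℕ} {V : Matrix (Fin l) (Fin l) ℂ}
    (hV : V ∈ Matrix.unitaryGroup (Fin l) ℂ) : Orthonormal ℂ (colVec V) := by
  rw [orthonormal_iff_ite]
  intro i j
  have h := congr_fun₂ (Matrix.mem_unitaryGroup_iff'.1 hV) i j
  rw [inner_colVec, ← Matrix.one_apply, ← h, Matrix.mul_apply]
  rfl

theorem mul_diagMat_mul_apply (V : Matrix (Fin m) (Fin m) ℂ) (W : Matrix (Fin n) (Fin n) ℂ)
    (x : Fin (min m n) → ℝ) (a : Fin m) (b : Fin n) :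
    (V * diagMat m n x * Wᴴ) a b =
      ∑ i, V a (rowEmb m n i) * (x i : ℂ) * star (W b (colEmb m n i)) := by
  simp only [Matrix.mul_apply, diagMat_apply, Finset.sum_mul, Finset.mul_sum,
    Matrix.conjTranspose_apply]
  rw [Finset.sum_congr rfl fun c _ => Finset.sum_comm, Finset.sum_comm]
  refine Finset.sum_congr rfl fun i _ => ?_
  rw [Finset.sum_eq_single (colEmb m n i), Finset.sum_eq_single (rowEmb m n i)]
  · simp
  · intro c _ hc; simp [hc]
  · simp
  · intro c _ hc; simp [hc]
  · simp

theorem toEuclideanLin_mul_diagMat_mul (V : Matrix (Fin m) (Fin m) ℂ)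
    (W : Matrix (Fin n) (Fin n) ℂ) (x : Fin (min m n) → ℝ) (y : EuclideanSpace ℂ (Fin n)) :
    Matrix.toEuclideanLin (V * diagMat m n x * Wᴴ) y =
      ∑ i, (x i : ℂ) • ⟪colVec W (colEmb m n i), y⟫_ℂ • colVec V (rowEmb m n i) := by
  ext a
  rw [Matrix.ofLp_toLpLin, Matrix.toLin'_apply]
  simp only [Matrix.mulVec, dotProduct, mul_diagMat_mul_apply, inner_colVec, Finset.sum_mul,
    WithLp.ofLp_sum, Finset.sum_apply, PiLp.smul_apply, smul_eq_mul, Finset.mul_sum]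
  rw [Finset.sum_comm]
  refine Finset.sum_congr rfl fun i _ => Finset.sum_congr rfl fun b _ => ?_
  simp only [colVec]
  ring

theorem svVec_antitone (F : Matrix (Fin m) (Fin n) ℂ) : Antitone (svVec F) :=
  fun _ _ h => LinearMap.singularValues_antitone _ h

theorem svVec_nonneg (F : Matrix (Fin m) (Fin n) ℂ) (i : Fin (min m n)) : 0 ≤ svVec F i :=
  LinearMap.singularValues_nonneg _ _

theorem mem_unitaryGroup_of_orthonormalBasis {l : ℕ}
    (b : OrthonormalBasis (Fin l) ℂ (EuclideanSpace ℂ (Fin l))) :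
    (Matrix.of fun a j => b j a) ∈ Matrix.unitaryGroup (Fin l) ℂ := by
  rw [Matrix.mem_unitaryGroup_iff']
  ext i j
  rw [Matrix.one_apply, ← orthonormal_iff_ite.1 b.orthonormal i j, Matrix.mul_apply]
  simp [PiLp.inner_apply, mul_comm]

/-- The singular value decomposition. -/
theorem exists_svd (F : Matrix (Fin m) (Fin n) ℂ) :
    ∃ V ∈ Matrix.unitaryGroup (Fin m) ℂ, ∃ W ∈ Matrix.unitaryGroup (Fin n) ℂ,
      F = V * diagMat m n (svVec F) * Wᴴ := by
  obtain ⟨c, b, h⟩ := exists_singular_bases finrank_euclideanSpace_fin finrank_euclideanSpace_fin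
    (Matrix.toEuclideanLin F)
  refine ⟨_, mem_unitaryGroup_of_orthonormalBasis c, _, mem_unitaryGroup_of_orthonormalBasis b, ?_⟩
  apply Matrix.toEuclideanLin.injective
  refine b.toBasis.ext fun j => ?_
  have hcol (i : Fin (min m n)) :
      colVec (Matrix.of fun a j => b j a) (colEmb m n i) = b (colEmb m n i) := rfl
  have hrow (i : Fin (min m n)) :
      colVec (Matrix.of fun a j => c j a) (rowEmb m n i) = c (rowEmb m n i) := rfl
  rw [b.coe_toBasis, h, toEuclideanLin_mul_diagMat_mul]
  simp only [hcol, hrow, orthonormal_iff_ite.1 b.orthonormal]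
  split_ifs with hj
  · have hj' : (j : ℕ) < min m n := lt_min hj j.2
    rw [Finset.sum_eq_single ⟨j, hj'⟩]
    · have hc : colEmb m n ⟨j, hj'⟩ = j := rfl
      rw [if_pos hc, one_smul]
      rfl
    · intro i _ hi
      rw [if_neg, zero_smul, smul_zero]
      rintro rfl
      exact hi rfl
    · simp
  · symm
    refine Finset.sum_eq_zero fun i _ => ?_
    rw [if_neg, zero_smul, smul_zero]
    rintro rfl
    exact hj (i.2.trans_le (min_le_left _ _))

theorem orthonormal_rowVec {V : Matrix (Fin m) (Fin m) ℂ}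
    (hV : V ∈ Matrix.unitaryGroup (Fin m) ℂ) :
    Orthonormal ℂ fun i => colVec V (rowEmb m n i) :=
  (orthonormal_colVec hV).comp _ (rowEmb m n).injective

theorem orthonormal_colVec_colEmb {W : Matrix (Fin n) (Fin n) ℂ}
    (hW : W ∈ Matrix.unitaryGroup (Fin n) ℂ) :
    Orthonormal ℂ fun i => colVec W (colEmb m n i) :=
  (orthonormal_colVec hW).comp _ (colEmb m n).injective

theorem svVec_mul_diagMat_mul_of_antitone {V : Matrix (Fin m) (Fin m) ℂ}
    {W : Matrix (Fin n) (Fin n) ℂ} (hV : V ∈ Matrix.unitaryGroup (Fin m) ℂ)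
    (hW : W ∈ Matrix.unitaryGroup (Fin n) ℂ) {x : Fin (min m n) → ℝ} (hx : Antitone x)
    (hx0 : ∀ i, 0 ≤ x i) : svVec (V * diagMat m n x * Wᴴ) = x := by
  obtain ⟨V', hV', W', hW', h⟩ := exists_svd (V * diagMat m n x * Wᴴ)
  refine singularFamily_unique finrank_euclideanSpace_fin finrank_euclideanSpace_fin
    (min_le_left m n) (orthonormal_rowVec hV') (orthonormal_colVec_colEmb hW')
    (orthonormal_rowVec hV) (orthonormal_colVec_colEmb hW) (svVec_antitone _) (svVec_nonneg _)
    hx hx0 (fun y => ?_) (fun y => toEuclideanLin_mul_diagMat_mul V W x y)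
  rw [← toEuclideanLin_mul_diagMat_mul V' W' _ y, ← h]

theorem exists_perm_svVec_mul_diagMat_mul {V : Matrix (Fin m) (Fin m) ℂ}
    {W : Matrix (Fin n) (Fin n) ℂ} (hV : V ∈ Matrix.unitaryGroup (Fin m) ℂ)
    (hW : W ∈ Matrix.unitaryGroup (Fin n) ℂ) (x : Fin (min m n) → ℝ) :
    ∃ σ : Equiv.Perm (Fin (min m n)),
      svVec (V * diagMat m n x * Wᴴ) = fun i => |x (σ i)| := by
  obtain ⟨σ, hσ⟩ := exists_perm_antitone fun i => |x i|
  obtain ⟨P, hP, Q, hQ, hPQ⟩ := exists_unitary_mul_diagMat_mul (m := m) (n := n) σ x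
  refine ⟨σ, ?_⟩
  have hP' : star P * P = 1 := Matrix.mem_unitaryGroup_iff'.1 hP
  have hQ' : Q * star Q = 1 := Matrix.mem_unitaryGroup_iff.1 hQ
  rw [← svVec_mul_diagMat_mul_of_antitone (mul_mem hV (Unitary.star_mem hP)) (mul_mem hW hQ) hσ
    fun i => abs_nonneg _, ← hPQ]
  congr 1
  simp only [← Matrix.star_eq_conjTranspose, star_mul, Matrix.mul_assoc]
  rw [← Matrix.mul_assoc Q, hQ', Matrix.one_mul, ← Matrix.mul_assoc (star P), hP', Matrix.one_mul]

/-- Mirsky's inequality. -/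
theorem IsSymmetricGauge.map_svVec_sub_le {Φ : Seminorm ℝ (Fin (min m n) → ℝ)}
    (hΦ : IsSymmetricGauge Φ) (A B : Matrix (Fin m) (Fin n) ℂ) :
    Φ (svVec A - svVec B) ≤ gaugeNorm Φ (A - B) := by
  obtain ⟨V, hV, W, hW, hA⟩ := exists_svd A
  obtain ⟨V', hV', W', hW', hB⟩ := exists_svd B
  obtain ⟨V'', hV'', W'', hW'', hC⟩ := exists_svd (A - B)
  refine hΦ.le_of_sum_le (svVec_nonneg _) fun S => ?_
  set w := svVec (A - B)
  have key (t : ℝ) (ht : 0 ≤ t) := sum_abs_sub_le (q := min m n)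
    finrank_euclideanSpace_fin finrank_euclideanSpace_fin
    (min_le_left m n) (min_le_right m n) (orthonormal_rowVec hV) (orthonormal_colVec_colEmb hW)
    (orthonormal_rowVec hV') (orthonormal_colVec_colEmb hW')
    (orthonormal_rowVec hV'') (orthonormal_colVec_colEmb hW'')
    (svVec_antitone A) (svVec_nonneg A) (svVec_antitone B) (svVec_nonneg B)
    (svVec_nonneg (A - B)) (w := w) (A := Matrix.toEuclideanLin A) (B := Matrix.toEuclideanLin B)
    (fun y => by rw [← toEuclideanLin_mul_diagMat_mul, ← hA])
    (fun y => by rw [← toEuclideanLin_mul_diagMat_mul, ← hB])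
    (fun y => by rw [← toEuclideanLin_mul_diagMat_mul, ← hC, map_sub]) S ht
  rcases Finset.eq_empty_or_nonempty S with rfl | hS
  · simp
  have hc := hS.card_pos
  have hcq : S.card ≤ min m n := by simpa using S.card_le_univ
  -- The threshold `t` is the `S.card`-th largest entry of `w` (index `S.card - 1`). Then the
  -- excesses are `w i - t` on the first `S.card` indices and `0` after, so the terms in `t` cancel.
  let l : Fin (min m n) := ⟨S.card - 1, by omega⟩
  refine (key (w l) (svVec_nonneg _ _)).trans_eq ?_
  have hmax (i : Fin (min m n)) : max (w i - w l) 0 =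
      (if (i : ℕ) < S.card then w i else 0) - if (i : ℕ) < S.card then w l else 0 := by
    split_ifs with h
    · refine max_eq_left (sub_nonneg.2 (svVec_antitone _ ?_))
      simp only [l, Fin.le_def]; omega
    · rw [sub_zero]
      refine max_eq_right (sub_nonpos.2 (svVec_antitone _ ?_))
      simp only [l, Fin.le_def]; omega
  simp only [hmax, Finset.sum_sub_distrib]
  rw [← Finset.sum_filter (fun i : Fin (min m n) => (i : ℕ) < S.card) (fun _ => w l),
    Finset.sum_const, Fin.card_filter_val_lt, min_eq_right hcq, nsmul_eq_mul]
  ring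

theorem finrank_range_toEuclideanLin (X : Matrix (Fin m) (Fin n) ℂ) :
    finrank ℂ (Matrix.toEuclideanLin X).range = X.rank := by
  rw [Matrix.toEuclideanLin, Matrix.toLpLin_eq_toLin, ← Matrix.rank_eq_finrank_range_toLin]

/-- The rank counts the positive singular values. A right singular vector with positive singular
value is orthogonal to the kernel, so isometry there forces the value `1`. -/
theorem svVec_eq_of_mem_partialIsometries {k : ℕ} {X : Matrix (Fin m) (Fin n) ℂ}
    (hX : X ∈ partialIsometries m n k) : svVec X = fun i : Fin (min m n) => if (i : ℕ) < k then 1 else 0 := by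
  obtain ⟨V, hV, W, hW, h⟩ := exists_svd X
  ext i
  have hpos : 0 < svVec X i ↔ (i : ℕ) < k := by
    rw [svVec, sv, LinearMap.singularValues_pos_iff_lt_finrank_range, finrank_range_toEuclideanLin,
      hX.2]
  split_ifs with hi
  · have h0 := hpos.2 hi
    have hT := toEuclideanLin_mul_diagMat_mul V W (svVec X)
    rw [← h] at hT
    have hv := orthonormal_rowVec (n := n) hV
    have hw := orthonormal_colVec_colEmb (m := m) hW
    have hker : colVec W (colEmb m n i) ∈ (LinearMap.ker (Matrix.toEuclideanLin X))ᗮ := by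
      intro f hf
      have h1 := congr_arg (fun z => ⟪colVec V (rowEmb m n i), z⟫_ℂ) (LinearMap.mem_ker.1 hf)
      simp only [hT, inner_zero_right, smul_smul] at h1
      rw [hv.inner_right_fintype] at h1
      have h2 : ⟪colVec W (colEmb m n i), f⟫_ℂ = 0 :=
        (mul_eq_zero.1 h1).resolve_left (by exact_mod_cast h0.ne')
      rw [← inner_conj_symm, h2, map_zero]
    have h3 := hX.1 _ hker
    have h4 : Matrix.toEuclideanLin X (colVec W (colEmb m n i)) =
        (svVec X i : ℂ) • colVec V (rowEmb m n i) := by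
      rw [hT, Finset.sum_eq_single i]
      · have := orthonormal_iff_ite.1 hw i i
        simp only [if_true] at this
        rw [this, one_smul]
      · intro j _ hj
        have := orthonormal_iff_ite.1 hw j i
        simp only [if_neg hj] at this
        rw [this, zero_smul, smul_zero]
      · simp
    rw [h4, norm_smul, hv.1 i, hw.1 i, mul_one, Complex.norm_real,
      Real.norm_of_nonneg h0.le] at h3
    exact h3
  · exact le_antisymm (not_lt.1 (mt hpos.1 hi)) (svVec_nonneg X i)

theorem truncIsometry_eq (k : ℕ) (V : Matrix (Fin m) (Fin m) ℂ) (W : Matrix (Fin n) (Fin n) ℂ) :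
    truncIsometry k V W = V * diagMat m n (fun i => if (i : ℕ) < k then 1 else 0) * Wᴴ := by
  rw [truncIsometry, blockDiag_eq_diagMat]

theorem isPartialIsometry_mul_diagMat_mul {V : Matrix (Fin m) (Fin m) ℂ}
    {W : Matrix (Fin n) (Fin n) ℂ} (hV : V ∈ Matrix.unitaryGroup (Fin m) ℂ)
    (hW : W ∈ Matrix.unitaryGroup (Fin n) ℂ) {x : Fin (min m n) → ℝ} (hx : ∀ i, x i * x i = x i) :
    IsPartialIsometry (V * diagMat m n x * Wᴴ) := by
  intro f hf
  have hx' (i) : (x i : ℂ) * x i = x i := by exact_mod_cast hx i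
  have hT := toEuclideanLin_mul_diagMat_mul V W x
  have hv := orthonormal_rowVec (n := n) hV
  have hw := orthonormal_colVec_colEmb (m := m) hW
  set T := Matrix.toEuclideanLin (V * diagMat m n x * Wᴴ)
  set u := fun i => colVec V (rowEmb m n i)
  set w := fun i => colVec W (colEmb m n i)
  replace hT (y) : T y = ∑ i, ((x i : ℂ) * ⟪w i, y⟫_ℂ) • u i := by
    rw [hT]
    simp only [smul_smul, u, w]
  -- `z` is the projection of `f` to the span of the `w i` with `x i = 1`. As `z - f` lies in the
  -- kernel, to which `f` is orthogonal, `⟪f, z⟫ = ⟪f, f⟫`, while `⟪T f, T f⟫ = ⟪f, z⟫`.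
  set z := ∑ i, ((x i : ℂ) * ⟪w i, f⟫_ℂ) • w i
  have hz : T z = T f := by
    rw [hT, hT]
    refine Finset.sum_congr rfl fun i _ => ?_
    rw [hw.inner_right_fintype, ← mul_assoc, hx']
  have h0 := (Submodule.mem_orthogonal' _ _).1 hf (z - f)
    (LinearMap.mem_ker.2 (by rw [map_sub, hz, sub_self]))
  rw [inner_sub_right, sub_eq_zero] at h0
  have h1 : ⟪T f, T f⟫_ℂ = ⟪f, z⟫_ℂ := by
    rw [hT, hv.inner_sum, inner_sum]
    refine Finset.sum_congr rfl fun i _ => ?_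
    rw [inner_smul_right, map_mul, Complex.conj_ofReal, inner_conj_symm]
    linear_combination ⟪f, w i⟫_ℂ * ⟪w i, f⟫_ℂ * hx' i
  rw [h0, inner_self_eq_norm_sq_to_K, inner_self_eq_norm_sq_to_K] at h1
  have h2 : ‖T f‖ ^ 2 = ‖f‖ ^ 2 := by exact_mod_cast h1
  exact (sq_eq_sq₀ (norm_nonneg _) (norm_nonneg _)).1 h2

theorem truncIsometry_mem {k : ℕ} (hk : k ≤ min m n) {V : Matrix (Fin m) (Fin m) ℂ}
    {W : Matrix (Fin n) (Fin n) ℂ} (hV : V ∈ Matrix.unitaryGroup (Fin m) ℂ)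
    (hW : W ∈ Matrix.unitaryGroup (Fin n) ℂ) :
    truncIsometry k V W ∈ partialIsometries m n k := by
  have hs := svVec_mul_diagMat_mul_of_antitone hV hW
    (x := fun i : Fin (min m n) => if (i : ℕ) < k then 1 else 0) (fun i j hij => by
      have : (i : ℕ) ≤ j := hij
      dsimp only
      split_ifs <;> first | omega | norm_num) (fun i => by split_ifs <;> norm_num)
  rw [← truncIsometry_eq] at hs
  refine ⟨?_, ?_⟩
  · rw [truncIsometry_eq]
    refine isPartialIsometry_mul_diagMat_mul hV hW fun i => ?_
    split_ifs <;> simp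
  · have h (i : Fin (min m n)) : (i : ℕ) < (truncIsometry k V W).rank ↔ (i : ℕ) < k := by
      rw [← finrank_range_toEuclideanLin, ← LinearMap.singularValues_pos_iff_lt_finrank_range]
      change 0 < svVec (truncIsometry k V W) i ↔ _
      rw [hs]
      dsimp only
      split_ifs with hi <;> simp [hi]
    have hr : (truncIsometry k V W).rank ≤ min m n :=
      le_min (Matrix.rank_le_height _) (Matrix.rank_le_width _)
    rcases lt_trichotomy (truncIsometry k V W).rank k with hlt | heq | hlt
    · exact absurd ((h ⟨_, hlt.trans_le hk⟩).2 hlt) (lt_irrefl _)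
    · exact heq
    · exact absurd ((h ⟨k, hlt.trans_le hr⟩).1 hlt) (lt_irrefl _)

/-- The easy half of von Neumann's correspondence: restrict `N` to diagonal matrices. Signed
permutations of the diagonal are unitary equivalences, and the decomposition of `F` recovers `N F`.
-/
theorem IsUnitarilyInvariantNorm.exists_gauge {N : Seminorm ℂ (Matrix (Fin m) (Fin n) ℂ)}
    (hN : IsUnitarilyInvariantNorm N) :
    ∃ Φ : Seminorm ℝ (Fin (min m n) → ℝ), IsSymmetricGauge Φ ∧ ∀ F, N F = gaugeNorm Φ F := by
  refine ⟨Seminorm.of (fun x => N (diagMat m n x))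
    (fun x y => by rw [diagMat_add]; exact map_add_le_add N _ _)
    (fun c x => by rw [diagMat_smul, map_smul_eq_mul, Complex.norm_real]), ⟨fun x hx => ?_,
    fun σ x => ?_⟩, fun F => ?_⟩
  · refine diagMat_injective ((hN.eq_zero_of_map_eq_zero _ hx).trans ?_)
    have := diagMat_smul (m := m) (n := n) 0 0
    simpa using this.symm
  · obtain ⟨P, hP, Q, hQ, h⟩ := exists_unitary_mul_diagMat_mul (m := m) (n := n) σ x
    change N (diagMat m n x) = N (diagMat m n fun i => |x (σ i)|)
    rw [← h, hN.map_unitary_mul_mul_unitary P hP Q hQ]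
  · obtain ⟨V, hV, W, hW, h⟩ := exists_svd F
    change N F = N (diagMat m n (svVec F))
    conv_lhs => rw [h]
    exact hN.map_unitary_mul_mul_unitary V hV _ (Unitary.star_mem hW) _

/-- Removes the cutoff at the rank: the truncated vector is nonincreasing and nonnegative, hence
already equal to `svVec F`. -/
theorem IsSVD.eq_mul_diagMat_mul {F : Matrix (Fin m) (Fin n) ℂ} {V : Matrix (Fin m) (Fin m) ℂ}
    {W : Matrix (Fin n) (Fin n) ℂ} (hF : IsSVD F V W) :
    F = V * diagMat m n (svVec F) * Wᴴ := by
  have h := hF.eq_mul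
  rw [blockDiag_eq_diagMat] at h
  have hs := svVec_mul_diagMat_mul_of_antitone hF.left_unitary hF.right_unitary
    (x := fun i : Fin (min m n) => if (i : ℕ) < F.rank then sv F i else 0) (fun i j hij => by
      have := svVec_antitone F hij
      have h0 := svVec_nonneg F i
      simp only [svVec] at this h0
      dsimp only
      split_ifs with h1 h2
      · exact this
      · exact absurd (lt_of_le_of_lt (Fin.le_def.1 hij) h1) h2
      · exact h0
      · exact le_rfl) (fun i => by
      split_ifs
      exacts [svVec_nonneg F i, le_rfl])
  rw [← h] at hs
  rw [hs]
  exact h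

theorem isLeast_gaugeNorm {k : ℕ} (hk : k ≤ min m n) {F : Matrix (Fin m) (Fin n) ℂ}
    {V : Matrix (Fin m) (Fin m) ℂ} {W : Matrix (Fin n) (Fin n) ℂ} (hF : IsSVD F V W)
    {Φ : Seminorm ℝ (Fin (min m n) → ℝ)} (hΦ : IsSymmetricGauge Φ) :
    IsLeast ((fun X => gaugeNorm Φ (F - X)) '' partialIsometries m n k)
      (gaugeNorm Φ (F - truncIsometry k V W)) := by
  refine ⟨⟨_, truncIsometry_mem hk hF.left_unitary hF.right_unitary, rfl⟩, ?_⟩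
  rintro _ ⟨X, hX, rfl⟩
  refine le_trans ?_ (hΦ.map_svVec_sub_le F X)
  rw [svVec_eq_of_mem_partialIsometries hX]
  have h : F - truncIsometry k V W =
      V * diagMat m n (svVec F - fun i : Fin (min m n) => if (i : ℕ) < k then 1 else 0) * Wᴴ := by
    rw [diagMat_sub, Matrix.mul_sub, Matrix.sub_mul, ← hF.eq_mul_diagMat_mul, truncIsometry_eq]
  obtain ⟨σ, hσ⟩ := exists_perm_svVec_mul_diagMat_mul hF.left_unitary hF.right_unitary
    (svVec F - fun i : Fin (min m n) => if (i : ℕ) < k then 1 else 0)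
  rw [gaugeNorm, h, hσ, ← hΦ.map_abs_perm]

end Matrix

end PartialIsometryApprox

theorem mainTheorem1 (m n k : ℕ) (hk1 : 1 ≤ k) (hkq : k ≤ min m n)
    (F : Matrix (Fin m) (Fin n) ℂ)
    (V : Matrix (Fin m) (Fin m) ℂ) (W : Matrix (Fin n) (Fin n) ℂ)
    (hF : PartialIsometryApprox.IsSVD F V W) :
    PartialIsometryApprox.truncIsometry k V W ∈ PartialIsometryApprox.partialIsometries m n k ∧
    (∀ Φ : Seminorm ℝ (Fin (min m n) → ℝ), PartialIsometryApprox.IsSymmetricGauge Φ →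
      IsLeast
        ((fun X => PartialIsometryApprox.gaugeNorm Φ (F - X)) ''
          PartialIsometryApprox.partialIsometries m n k)
        (PartialIsometryApprox.gaugeNorm Φ (F - PartialIsometryApprox.truncIsometry k V W))) ∧
    (∀ N : Seminorm ℂ (Matrix (Fin m) (Fin n) ℂ),
      PartialIsometryApprox.IsUnitarilyInvariantNorm N →
      IsLeast
        ((fun X => N (F - X)) '' PartialIsometryApprox.partialIsometries m n k)
        (N (F - PartialIsometryApprox.truncIsometry k V W))) := by
  refine ⟨PartialIsometryApprox.truncIsometry_mem hkq hF.left_unitary hF.right_unitary,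
    fun Φ hΦ => PartialIsometryApprox.isLeast_gaugeNorm hkq hF hΦ, fun N hN => ?_⟩
  obtain ⟨Φ, hΦ, h⟩ := hN.exists_gauge
  simpa only [h] using PartialIsometryApprox.isLeast_gaugeNorm hkq hF hΦ
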